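/- Let $N=p_1\cdots p_s$ be an odd square-free positive integer and let $k\in\mathbb{Z}$. If $3\mid N$, assume in addition that $3\mid k$ or that $N$ has a prime divisor $p\equiv 2\pmod 3$. If $$\gcd\Bigl(\gcd_{\delta\mid N,\ \delta\neq N}\bigl(\tfrac{N}{\delta}-1\bigr),\,24\Bigr)\ \Big|\ 2k$$ (for $N=1$ the inner gcd is $0$, so the condition is $24\mid 2k$), then $M_k^!(\Gamma_1(N))$ contains $\eta$-quotients, that is, there are integers $r_\delta$ $(\delta\mid N)$ such that $f(z)=\prod_{\delta\mid N}\eta(\delta z)^{r_\delta}$ belongs to $M_k^!(\Gamma_1(N))$. Here $\eta(z)=q^{1/24}\prod_{n\ge1}(1-q^n)$ with $q=e^{2\pi i z}$ is Dedekind's eta-function, and $M_k^!(\Gamma_1(N))$ is the space of functions $f$ on the upper half-plane that are holomorphic, satisfy $f|_k\gamma=f$ for all $\gamma\in\Gamma_1(N)$, where $(f|_k\gamma)(z)=(cz+d)^{-k}f\bigl(\tfrac{az+b}{cz+d}\bigr)$ for $\gamma=\begin{pmatrix}a&b\\c&d\end{pmatrix}$, and are meromorphic at every cusp: for every $\gamma\in\mathrm{SL}_2(\mathbb{Z})$,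 $f|_k\gamma$ has for some integer $h\ge1$ an expansion $\sum_{n\ge n_0}a_n e^{2\pi i n z/h}$ with $n_0\in\mathbb{Z}$. -/

import Mathlib

open UpperHalfPlane ModularForm CongruenceSubgroup
open scoped MatrixGroups Manifold

noncomputable section

/-- A function on the upper half-plane is meromorphic at `i∞` if, for some period `h ≥ 1`, it has a
Fourier expansion `∑ aₙ q_h ^ n`, `q_h = exp (2 π i z / h)`, whose coefficients `aₙ` vanish for all
`n` below some bound. -/
def MeromorphicAtImInfty (g : ℍ → ℂ) : Prop :=
  ∃ h : ℕ, 0 < h ∧ ∃ (a : ℤ → ℂ) (c : ℤ), (∀ n < c, a n = 0) ∧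
    ∀ z : ℍ, HasSum (fun n : ℤ => a n * Function.Periodic.qParam (h : ℝ) (z : ℂ) ^ n) (g z)

/-- The period of the expansion may be replaced by any positive multiple. -/
theorem fourier_rescale {g : ℍ → ℂ} {h m : ℕ} (hm : 0 < m)
    (H : ∃ (a : ℤ → ℂ) (c : ℤ), (∀ n < c, a n = 0) ∧
      ∀ z : ℍ, HasSum (fun n : ℤ => a n * Function.Periodic.qParam (h : ℝ) (z : ℂ) ^ n) (g z)) :
    ∃ (a : ℤ → ℂ) (c : ℤ), (∀ n < c, a n = 0) ∧
      ∀ z : ℍ, HasSum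
        (fun n : ℤ => a n * Function.Periodic.qParam ((h * m : ℕ) : ℝ) (z : ℂ) ^ n) (g z) := by
  obtain ⟨a, c, hc, hs⟩ := H
  have hm0 : (m : ℤ) ≠ 0 := by exact_mod_cast hm.ne'
  have hmC : (m : ℂ) ≠ 0 := by exact_mod_cast hm.ne'
  refine ⟨fun n => if (m : ℤ) ∣ n then a (n / m) else 0, c * m, ?_, fun z => ?_⟩
  · intro n hn
    show (if (m : ℤ) ∣ n then a (n / m) else 0) = 0
    split_ifs with hd
    · obtain ⟨j, rfl⟩ := hd
      rw [Int.mul_ediv_cancel_left _ hm0]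
      apply hc
      have : (0 : ℤ) < m := by exact_mod_cast hm
      nlinarith
    · rfl
  · have hinj : Function.Injective (fun j : ℤ => (m : ℤ) * j) := mul_right_injective₀ hm0
    rw [← hinj.hasSum_iff]
    · convert hs z using 2 with j
      have hq : Function.Periodic.qParam ((h * m : ℕ) : ℝ) (z : ℂ) ^ (m : ℤ) =
          Function.Periodic.qParam (h : ℝ) (z : ℂ) := by
        simp only [Function.Periodic.qParam, ← Complex.exp_int_mul]
        congr 1
        push_cast
        rw [mul_comm (h : ℂ) m, mul_div_assoc', mul_div_mul_left _ _ hmC]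
      simp [Int.mul_ediv_cancel_left _ hm0, zpow_mul, ← hq]
    · intro n hn
      have : ¬ (m : ℤ) ∣ n := by
        rintro ⟨j, rfl⟩
        exact hn ⟨j, rfl⟩
      simp [this]

theorem MeromorphicAtImInfty.add {f g : ℍ → ℂ} (hf : MeromorphicAtImInfty f)
    (hg : MeromorphicAtImInfty g) : MeromorphicAtImInfty (f + g) := by
  obtain ⟨h, hh, Hf⟩ := hf
  obtain ⟨m, hm, Hg⟩ := hg
  obtain ⟨a, c, hc, ha⟩ := fourier_rescale hm Hf
  obtain ⟨b, d, hd, hb⟩ := fourier_rescale hh Hg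
  rw [mul_comm m h] at hb
  refine ⟨h * m, Nat.mul_pos hh hm, a + b, min c d, fun n hn => ?_, fun z => ?_⟩
  · simp [hc n (lt_of_lt_of_le hn (min_le_left _ _)), hd n (lt_of_lt_of_le hn (min_le_right _ _))]
  · simpa [add_mul] using (ha z).add (hb z)

theorem MeromorphicAtImInfty.smul {f : ℍ → ℂ} (t : ℂ) (hf : MeromorphicAtImInfty f) :
    MeromorphicAtImInfty (t • f) := by
  obtain ⟨h, hh, a, c, hc, ha⟩ := hf
  refine ⟨h, hh, t • a, c, fun n hn => by simp [hc n hn], fun z => ?_⟩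
  simpa [mul_assoc] using (ha z).mul_left t

/-- The space `M_k^!(Γ)` of weakly modular functions of weight `k` and level `Γ`: functions that are
holomorphic on the upper half-plane, invariant under the weight `k` action of `Γ`, and meromorphic
at every cusp. Every cusp has the form `γ • i∞` with `γ ∈ SL(2, ℤ)`, and `f` is meromorphic there
if `f ∣[k] γ` is meromorphic at `i∞`. -/
def weaklyModularFunctions (Γ : Subgroup SL(2, ℤ)) (k : ℤ) : Submodule ℂ (ℍ → ℂ) where
  carrier := {f | MDifferentiable 𝓘(ℂ) 𝓘(ℂ) f ∧ (∀ γ ∈ Γ, f ∣[k] γ = f) ∧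
    ∀ γ : SL(2, ℤ), MeromorphicAtImInfty (f ∣[k] γ)}
  zero_mem' := by
    refine ⟨mdifferentiable_const, fun γ _ => by simp, fun γ => ?_⟩
    refine ⟨1, one_pos, 0, 0, by simp, fun z => ?_⟩
    simp [hasSum_zero]
  add_mem' := by
    rintro f g ⟨hf, hf', hf''⟩ ⟨hg, hg', hg''⟩
    refine ⟨hf.add hg, fun γ hγ => ?_, fun γ => ?_⟩
    · rw [SlashAction.add_slash, hf' γ hγ, hg' γ hγ]
    · rw [SlashAction.add_slash]
      exact (hf'' γ).add (hg'' γ)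
  smul_mem' := by
    rintro t f ⟨hf, hf', hf''⟩
    refine ⟨hf.const_smul t, fun γ hγ => ?_, fun γ => ?_⟩
    · rw [ModularForm.SL_smul_slash, hf' γ hγ]
    · rw [ModularForm.SL_smul_slash]
      exact (hf'' γ).smul t

/-- The `η`-quotient `z ↦ ∏_{δ ∣ N} η(δ z) ^ r_δ`, with `η` the Dedekind eta function. -/
def etaQuotient (N : ℕ) (r : ℕ → ℤ) (z : ℍ) : ℂ :=
  ∏ δ ∈ N.divisors, ModularForm.eta ((δ : ℂ) * (z : ℂ)) ^ r δ

/-- `f` is an `η`-quotient `∏_{δ ∣ N} η(δ z) ^ r_δ` with integer exponents. -/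
def IsEtaQuotient (N : ℕ) (f : ℍ → ℂ) : Prop :=
  ∃ r : ℕ → ℤ, f = etaQuotient N r

end

/-! ### The principal square root -/

/-! For odd `N`, an η-quotient has weight `k` on `Γ₁(N)` as soon as `∑ r_δ = 2k`, `24 ∣ ∑ δ r_δ` and
`24 ∣ ∑ (N/δ) r_δ`; meromorphy at the cusps is then automatic, and the theorem becomes a system of
congruences.

Invariance rests on the explicit η-multiplier for odd `d > 0`, a Jacobi symbol times a 24th root of
unity (`etaRule`). It is proved by a Euclidean descent on the bottom row, quadratic reciprocity
accounting for the inversion. Applied to `η(δz)` with `N = δm` and `d ≡ 1 mod N`, reciprocity also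
removes the symbol `(m/d)`. What remains is the δ-independent symbol `(c/d)`, killed by the even
total exponent, and a root of unity whose exponent is linear in `m` and `δ`, killed by the two
congruences.

At a cusp only 24th powers are compared. Since `η²⁴ = Δ` is modular of level one, `(f ∣[k] γ)²⁴` is
a constant times the 24th power of an explicit product of values `η((Az+B)/D)`. By connectedness `f
∣[k] γ` is itself a constant multiple of that product, whose q-expansion is visible.

For the congruences, `∑ r_δ = 2k` turns the `N/δ` condition into `∑ (N/δ - 1) r_δ ≡ -2k mod 24`, in
which `r_N` is free; the gcd hypothesis is exactly its solvability. Units square to 1 modulo 8 and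
modulo 3, so the condition on `∑ δ r_δ` follows modulo 8, and modulo 3 if `3 ∤ N`. When `3 ∣ N`, a
separate solution modulo 3 is glued in. -/

theorem Complex.sqrt_pow_two (z : ℂ) : Complex.sqrt z ^ 2 = z := by
  simp [Complex.sqrt]

theorem Complex.sqrt_re_pos {z : ℂ} (hz : z ∈ Complex.slitPlane) : 0 < (Complex.sqrt z).re := by
  rw [Complex.sqrt, Complex.cpow_inv_two_re]
  apply Real.sqrt_pos.mpr
  rcases hz with h | h
  · have := norm_nonneg z
    linarith
  · have := Complex.abs_re_lt_norm.mpr h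
    have := neg_abs_le z.re
    linarith

theorem Complex.sqrt_eq_of_sq {w z : ℂ} (hw : 0 < w.re) (h : w ^ 2 = z) : Complex.sqrt z = w := by
  rw [← h, Complex.sqrt, Complex.sq_cpow_two_inv hw]

theorem Complex.im_sq (w : ℂ) : (w ^ 2).im = 2 * w.re * w.im := by
  simp [sq]; ring

theorem Complex.sqrt_im_pos {z : ℂ} (hz : 0 < z.im) : 0 < (Complex.sqrt z).im := by
  have h1 := Complex.sqrt_re_pos (Or.inr hz.ne')
  have h2 := Complex.im_sq (Complex.sqrt z)
  rw [Complex.sqrt_pow_two] at h2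
  rw [h2] at hz
  exact pos_of_mul_pos_right hz (by linarith)

/-- The arguments lie in `(-π, 0]` and `(0, π)`, so their sum stays in `(-π, π)` and no branch is
crossed. -/
theorem Complex.sqrt_mul_sqrt_of_im_nonpos {x y : ℂ} (hx : x ∈ Complex.slitPlane) (hx' : x.im ≤ 0)
    (hy : 0 < y.im) : Complex.sqrt x * Complex.sqrt y = Complex.sqrt (x * y) := by
  refine (Complex.sqrt_eq_of_sq ?_ (by rw [mul_pow, sqrt_pow_two, sqrt_pow_two])).symm
  have h1 := Complex.sqrt_re_pos hx
  have h2 := Complex.sqrt_re_pos (z := y) (Or.inr hy.ne')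
  have h3 := Complex.sqrt_im_pos hy
  have h4 : (Complex.sqrt x).im ≤ 0 := by
    have h2 := Complex.im_sq (Complex.sqrt x)
    rw [Complex.sqrt_pow_two] at h2
    by_contra! h
    have : 0 < 2 * (Complex.sqrt x).re * (Complex.sqrt x).im := by positivity
    linarith
  rw [Complex.mul_re]
  nlinarith [mul_pos h1 h2, mul_nonneg (neg_nonneg.mpr h4) h3.le]

theorem Complex.sqrt_mul_sqrt_of_im_pos {x y : ℂ} (hx : 0 < x.im) (hy : 0 < y.im)
    (hxy : 0 < (x * y).im) : Complex.sqrt x * Complex.sqrt y = Complex.sqrt (x * y) := by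
  have hsq : (Complex.sqrt x * Complex.sqrt y) ^ 2 = x * y := by
    rw [mul_pow, sqrt_pow_two, sqrt_pow_two]
  refine (Complex.sqrt_eq_of_sq ?_ hsq).symm
  have h1 := Complex.sqrt_re_pos (z := x) (Or.inr hx.ne')
  have h2 := Complex.sqrt_re_pos (z := y) (Or.inr hy.ne')
  have h3 := Complex.sqrt_im_pos hx
  have h4 := Complex.sqrt_im_pos hy
  have h5 : 0 < (Complex.sqrt x * Complex.sqrt y).im := by
    rw [Complex.mul_im]; positivity
  have h6 := Complex.im_sq (Complex.sqrt x * Complex.sqrt y)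
  rw [hsq] at h6
  rw [h6] at hxy
  have := pos_of_mul_pos_left hxy h5.le
  linarith

/-- The product of the roots has argument in `(0, π)`; dividing by `I` moves it into the right
half-plane, where it is the principal root. -/
theorem Complex.sqrt_mul_sqrt_neg {x y : ℂ} (hx : 0 < x.im) (hy : 0 < y.im) :
    Complex.sqrt x * Complex.sqrt y = Complex.I * Complex.sqrt (-(x * y)) := by
  have hsq : (Complex.sqrt x * Complex.sqrt y) ^ 2 = x * y := by
    rw [mul_pow, sqrt_pow_two, sqrt_pow_two]
  rw [Complex.sqrt_eq_of_sq (z := -(x * y)) (w := -Complex.I * (Complex.sqrt x * Complex.sqrt y)) ?_ ?_]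
  · linear_combination (Complex.sqrt x * Complex.sqrt y) * Complex.I_sq
  · have h1 := Complex.sqrt_re_pos (z := x) (Or.inr hx.ne')
    have h2 := Complex.sqrt_re_pos (z := y) (Or.inr hy.ne')
    have h3 := Complex.sqrt_im_pos hx
    have h4 := Complex.sqrt_im_pos hy
    have : 0 < (Complex.sqrt x * Complex.sqrt y).im := by
      rw [Complex.mul_im]; positivity
    simpa using this
  · rw [mul_pow, hsq]
    simp

/-! ### The 24th root of unity attached to the Dedekind eta function -/

/-- The root of unity `exp (2 π i / 24)`. -/
noncomputable def zeta24 : ℂ := Complex.exp (2 * Real.pi * Complex.I / 24)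

theorem zeta24_ne_zero : zeta24 ≠ 0 := Complex.exp_ne_zero _

theorem zeta24_zpow (n : ℤ) : zeta24 ^ n = Complex.exp (2 * Real.pi * Complex.I * n / 24) := by
  rw [zeta24, ← Complex.exp_int_mul]
  congr 1
  ring

theorem zeta24_zpow_of_dvd {n : ℤ} (h : 24 ∣ n) : zeta24 ^ n = 1 := by
  obtain ⟨m, rfl⟩ := h
  rw [zeta24_zpow, Complex.exp_eq_one_iff]
  refine ⟨m, ?_⟩
  push_cast
  ring

theorem zeta24_zpow_congr {m n : ℤ} (h : 24 ∣ m - n) : zeta24 ^ m = zeta24 ^ n := by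
  rw [← sub_add_cancel m n, zpow_add₀ zeta24_ne_zero, zeta24_zpow_of_dvd h, one_mul]

theorem zeta24_zpow_twelve : zeta24 ^ (12 : ℤ) = -1 := by
  rw [zeta24_zpow, ← Complex.exp_pi_mul_I]
  congr 1
  push_cast
  ring

theorem zeta24_zpow_six : zeta24 ^ (6 : ℤ) = Complex.I := by
  rw [zeta24_zpow]
  refine Eq.trans ?_ Complex.exp_pi_div_two_mul_I
  congr 1
  push_cast
  ring

theorem neg_one_pow_eq_zeta24 (n : ℕ) : (-1 : ℂ) ^ n = zeta24 ^ (12 * n : ℤ) := by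
  rw [zpow_mul, zeta24_zpow_twelve, zpow_natCast]

theorem sqrt_I_eq_zeta24 : Complex.sqrt Complex.I = zeta24 ^ (3 : ℤ) := by
  apply Complex.sqrt_eq_of_sq
  · rw [zeta24_zpow, Complex.exp_re]
    have : (2 * Real.pi * Complex.I * (3 : ℤ) / 24 : ℂ) = ((Real.pi / 4 : ℝ) : ℂ) * Complex.I := by
      push_cast; ring
    rw [this]
    simp
  · rw [← zpow_natCast, ← zpow_mul, ← zeta24_zpow_six]
    norm_num

/-! ### Transformation of the eta function under generators -/

theorem eta_add_one (z : ℂ) : eta (z + 1) = zeta24 * eta z := by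
  have h : ∀ n, eta_q n (z + 1) = eta_q n z := fun n => by
    simp [eta_q, Function.Periodic.qParam, mul_add, Complex.exp_add]
  simp only [eta, h, ← mul_assoc]
  congr 1
  rw [zeta24, Function.Periodic.qParam, Function.Periodic.qParam, ← Complex.exp_add]
  congr 1
  push_cast
  ring

theorem eta_add_int (z : ℂ) (n : ℤ) : eta (z + n) = zeta24 ^ n * eta z := by
  induction n using Int.induction_on with
  | zero => simp
  | succ n ih =>
    push_cast at ih ⊢
    rw [← add_assoc, eta_add_one, ih, zpow_add_one₀ zeta24_ne_zero]
    ring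
  | pred n ih =>
    have := eta_add_one (z + ((-n - 1 : ℤ) : ℂ))
    push_cast at this ih ⊢
    rw [show z + (-(n : ℂ) - 1) + 1 = z + -n by ring, ih] at this
    rw [zpow_sub_one₀ zeta24_ne_zero]
    have h0 := zeta24_ne_zero
    field_simp
    linear_combination -this

theorem eta_neg_inv {z : ℂ} (hz : 0 < z.im) :
    eta (-1 / z) = zeta24 ^ (-3 : ℤ) * (Complex.sqrt z * eta z) := by
  have := eta_comp_eq_csqrt_I_inv hz
  rw [sqrt_I_eq_zeta24, ← zpow_neg] at this
  simpa using this

theorem neg_inv_im_pos {z : ℂ} (hz : 0 < z.im) : 0 < (-1 / z).im := by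
  have : z ≠ 0 := by rintro rfl; simp at hz
  rw [neg_div, one_div, Complex.neg_im, Complex.inv_im, neg_div, neg_neg]
  exact div_pos hz (Complex.normSq_pos.mpr this)

theorem div_add_one_im_pos {z : ℂ} (hz : 0 < z.im) : 0 < (z / (z + 1)).im := by
  have h0 : z ≠ 0 := by rintro rfl; simp at hz
  have h1 : z + 1 ≠ 0 := by
    intro h
    have := congrArg Complex.im h
    simp at this
    linarith
  have h2 := neg_inv_im_pos (z := -1 / z - 1) (by simpa using neg_inv_im_pos hz)
  convert h2 using 2
  have h3 : -1 / z - 1 = -(z + 1) / z := by field_simp; ring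
  rw [h3]
  field_simp

/-- The map is the word `S T⁻¹ S`, since `z/(z+1) = -1/(-1/z - 1)`; the two square roots combine to
`I * sqrt (z + 1)`. -/
theorem eta_div_add_one {z : ℂ} (hz : 0 < z.im) :
    eta (z / (z + 1)) = zeta24 ^ (-1 : ℤ) * (Complex.sqrt (z + 1) * eta z) := by
  have h0 : z ≠ 0 := by rintro rfl; simp at hz
  have h1 : z + 1 ≠ 0 := by
    intro h
    have := congrArg Complex.im h
    simp at this
    linarith
  have h3 : -1 / z - 1 = -(z + 1) / z := by field_simp; ring
  have h4 : z / (z + 1) = -1 / (-1 / z - 1) := by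
    rw [h3]
    field_simp
  have him : 0 < (-1 / z - 1).im := by simpa using neg_inv_im_pos hz
  have hxy : (-1 / z - 1) * z = -(z + 1) := by rw [h3]; field_simp
  have hs := Complex.sqrt_mul_sqrt_neg him hz
  rw [hxy, neg_neg] at hs
  have he := eta_add_int (-1 / z) (-1)
  push_cast at he
  rw [← sub_eq_add_neg] at he
  rw [h4, eta_neg_inv him, he, eta_neg_inv hz]
  calc zeta24 ^ (-3 : ℤ) * (Complex.sqrt (-1 / z - 1) *
        (zeta24 ^ (-1 : ℤ) * (zeta24 ^ (-3 : ℤ) * (Complex.sqrt z * eta z))))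
      = zeta24 ^ (-3 : ℤ) * zeta24 ^ (-3 : ℤ) * zeta24 ^ (-1 : ℤ) *
        (Complex.sqrt (-1 / z - 1) * Complex.sqrt z) * eta z := by ring
    _ = _ := by
      rw [hs, ← zeta24_zpow_six, ← zpow_add₀ zeta24_ne_zero]
      norm_num
      have h0 := zeta24_ne_zero
      field_simp

/-! ### The eta multiplier for matrices with odd positive lower right entry -/

/-- The exponent of the 24th root of unity in the eta multiplier. -/
def etaExponent (a b c d : ℤ) : ℤ := (a + d) * c - b * d * (c ^ 2 - 1) + 3 * d - 3 - 3 * c * d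

/-- The transformation formula of `η` under `z ↦ (a z + b) / (c z + d)`. -/
def EtaRule (a b c : ℤ) (d : ℕ) : Prop :=
  ∀ z : ℂ, 0 < z.im → eta ((a * z + b) / (c * z + d)) =
    (jacobiSym c d : ℂ) * zeta24 ^ etaExponent a b c d * (Complex.sqrt (c * z + d) * eta z)

theorem add_natCast_mem_slitPlane (c : ℤ) {d : ℕ} (hd : 0 < d) {z : ℂ} (hz : 0 < z.im) :
    c * z + d ∈ Complex.slitPlane := by
  rcases eq_or_ne c 0 with rfl | hc
  · left; simpa using hd
  · right; simp [hc, hz.ne']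

/-- The difference is a multiple of `d² - 1`, hence of 8. Modulo 3 either `3 ∣ d² - 1`, or `3 ∣ d`
and the determinant gives `bc ≡ -1`, which kills the other factor. -/
theorem etaExponent_add {a b c d : ℤ} (hd : Odd d) (h : a * d - b * c = 1) :
    24 ∣ etaExponent (a + b) b (c + d) d - (etaExponent a b c d - 1) := by
  have h8 : (8 : ℤ) ∣ d ^ 2 - 1 := Int.eight_dvd_sq_sub_one_of_odd hd
  have e : etaExponent (a + b) b (c + d) d - (etaExponent a b c d - 1) =
      -(d ^ 2 - 1) * (2 * b * c + b * d + 2) := by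
    unfold etaExponent
    linear_combination h
  rw [e]
  have h3 : (3 : ℤ) ∣ (d ^ 2 - 1) * (2 * b * c + b * d + 2) := by
    have hd3 : d % 3 = 0 ∨ d % 3 = 1 ∨ d % 3 = 2 := by omega
    rcases hd3 with hd3 | hd3 | hd3
    · obtain ⟨m, rfl⟩ : (3 : ℤ) ∣ d := by omega
      refine Dvd.dvd.mul_left ⟨2 * a * m + b * m, ?_⟩ _
      linear_combination -2 * h
    · exact Dvd.dvd.mul_right (by rw [Int.dvd_iff_emod_eq_zero, Int.sub_emod, pow_two, Int.mul_emod, hd3]; rfl) _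
    · exact Dvd.dvd.mul_right (by rw [Int.dvd_iff_emod_eq_zero, Int.sub_emod, pow_two, Int.mul_emod, hd3]; rfl) _
  have h8' := h8.mul_right (2 * b * c + b * d + 2)
  rw [neg_mul]
  omega

/-- This is right multiplication by the matrix with rows `(1, 0)` and `(1, 1)`: substitute `z/(z+1)`
and use that `d > 0` keeps the automorphy factors on one branch. It allows `c` to be reduced modulo
`d`. -/
theorem etaRule_add_iff {a b c : ℤ} {d : ℕ} (hd : Odd d) (h : a * d - b * c = 1) :
    EtaRule (a + b) b (c + d) d ↔ EtaRule a b c d := by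
  have hJ : jacobiSym (c + d) d = jacobiSym c d := jacobiSym.mod_left' (by simp)
  have key : ∀ z : ℂ, 0 < z.im →
      ((eta ((((a + b : ℤ) : ℂ) * z + b) / (((c + d : ℤ) : ℂ) * z + d)) =
        (jacobiSym (c + d) d : ℂ) * zeta24 ^ etaExponent (a + b) b (c + d) d *
          (Complex.sqrt (((c + d : ℤ) : ℂ) * z + d) * eta z)) ↔
      (eta ((a * (z / (z + 1)) + b) / (c * (z / (z + 1)) + d)) =
        (jacobiSym c d : ℂ) * zeta24 ^ etaExponent a b c d *
          (Complex.sqrt (c * (z / (z + 1)) + d) * eta (z / (z + 1))))) := by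
    intro z hz
    have h1 : z + 1 ≠ 0 := by
      intro h
      have := congrArg Complex.im h
      simp at this
      linarith
    have e1 : (((a + b : ℤ) : ℂ) * z + b) / (((c + d : ℤ) : ℂ) * z + d) =
        (a * (z / (z + 1)) + b) / (c * (z / (z + 1)) + d) := by
      rw [← mul_div_mul_right (a * (z / (z + 1)) + b) _ h1]
      congr 1 <;> push_cast <;> field_simp <;> ring
    have hw := div_add_one_im_pos hz
    have hprod : (c * (z / (z + 1)) + d) * (z + 1) = ((c + d : ℤ) : ℂ) * z + d := by
      push_cast; field_simp; ring
    have hz1 : 0 < (z + 1).im := by simpa using hz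
    have hs : Complex.sqrt (c * (z / (z + 1)) + d) * Complex.sqrt (z + 1) =
        Complex.sqrt (((c + d : ℤ) : ℂ) * z + d) := by
      rw [← hprod]
      rcases le_or_gt c 0 with hc | hc
      · refine Complex.sqrt_mul_sqrt_of_im_nonpos (add_natCast_mem_slitPlane c hd.pos hw) ?_ hz1
        have : (c : ℝ) ≤ 0 := by exact_mod_cast hc
        simpa using mul_nonpos_of_nonpos_of_nonneg this hw.le
      · have hc' : (0 : ℝ) < c := by exact_mod_cast hc
        refine Complex.sqrt_mul_sqrt_of_im_pos ?_ hz1 ?_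
        · simpa using mul_pos hc' hw
        · rw [hprod]
          have hd' : (0 : ℝ) < d := by exact_mod_cast hd.pos
          simpa using mul_pos (add_pos hc' hd') hz
    rw [e1, hJ, zeta24_zpow_congr (etaExponent_add (by exact_mod_cast hd) h), ← hs,
      eta_div_add_one hz, sub_eq_add_neg, zpow_add₀ zeta24_ne_zero]
    constructor <;> intro H <;> rw [H] <;> ring
  constructor
  · intro H w hw
    -- The point `w/(1-w)`, the preimage of `w` under `z ↦ z/(z+1)`, written so that its imaginary
    -- part is evidently positive.
    have hz : 0 < (-1 / (-1 / w + 1)).im := neg_inv_im_pos (by simpa using neg_inv_im_pos hw)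
    have h0 : w ≠ 0 := by rintro rfl; simp at hw
    have h1 : -1 + w ≠ 0 := by
      intro h
      have := congrArg Complex.im h
      simp at this
      linarith
    have e : (-1 / (-1 / w + 1)) / ((-1 / (-1 / w + 1)) + 1) = w := by
      have : -1 / (-1 / w + 1) = -w / (-1 + w) := by field_simp
      rw [this]
      field_simp
      ring
    have := (key _ hz).1 (H _ hz)
    rwa [e] at this
  · intro H z hz
    exact (key z hz).2 (H _ (div_add_one_im_pos hz))

theorem etaRule_add_mul_iff {a b c : ℤ} {d : ℕ} (hd : Odd d) (h : a * d - b * c = 1) (j : ℤ) :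
    EtaRule (a + j * b) b (c + j * d) d ↔ EtaRule a b c d := by
  induction j using Int.induction_on with
  | zero => simp
  | succ n ih =>
    rw [← ih, ← etaRule_add_iff (a := a + n * b) (c := c + n * d) hd (by linear_combination h)]
    simp only [add_mul, one_mul, add_assoc]
  | pred n ih =>
    rw [← ih, ← etaRule_add_iff (a := a + (-n - 1) * b) (c := c + (-n - 1) * d) hd
      (by linear_combination h)]
    ring_nf

theorem jacobiSym_cast_reciprocity {m n : ℕ} (hm : Odd m) (hn : Odd n) :
    (jacobiSym m n : ℂ) = zeta24 ^ (3 * (m - 1) * (n - 1) : ℤ) * (jacobiSym n m : ℂ) := by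
  rw [jacobiSym.quadratic_reciprocity hm hn]
  push_cast
  rw [neg_one_pow_eq_zeta24]
  congr 2
  obtain ⟨u, rfl⟩ := hm
  obtain ⟨v, rfl⟩ := hn
  rw [show (2 * u + 1) / 2 = u by omega, show (2 * v + 1) / 2 = v by omega]
  push_cast
  ring

theorem jacobiSym_cast_neg (a : ℤ) {n : ℕ} (hn : Odd n) :
    (jacobiSym (-a) n : ℂ) = zeta24 ^ (6 * (n - 1) : ℤ) * (jacobiSym a n : ℂ) := by
  rw [jacobiSym.neg _ hn, ZMod.χ₄_eq_neg_one_pow (Nat.odd_iff.mp hn)]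
  push_cast
  rw [neg_one_pow_eq_zeta24]
  congr 2
  obtain ⟨v, rfl⟩ := hn
  rw [show (2 * v + 1) / 2 = v by omega]
  push_cast
  ring

/-- Right multiplication by `S`, up to sign, exchanges the bottom entries, so reciprocity must match
the change of the root of unity. -/
theorem EtaRule.of_inv_pos {a b : ℤ} {e d : ℕ} (he : Odd e) (hd : Odd d)
    (h : a * d - b * e = 1) (H : EtaRule (-b) a (-d) e) : EtaRule a b e d := by
  intro z hz
  have h0 : z ≠ 0 := by rintro rfl; simp at hz
  have hw := neg_inv_im_pos hz
  have hx : (((-d : ℤ) : ℂ) * (-1 / z) + e) * z = (e : ℤ) * z + d := by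
    push_cast; field_simp; ring
  have hH := H _ hw
  have e1 : (((-b : ℤ) : ℂ) * (-1 / z) + a) / (((-d : ℤ) : ℂ) * (-1 / z) + e) =
      (a * z + b) / ((e : ℤ) * z + d) := by
    rw [← mul_div_mul_right _ _ h0, hx]
    congr 1
    push_cast; field_simp; ring
  have hs : Complex.sqrt (((-d : ℤ) : ℂ) * (-1 / z) + e) * Complex.sqrt z =
      Complex.sqrt ((e : ℤ) * z + d) := by
    rw [← hx]
    refine Complex.sqrt_mul_sqrt_of_im_nonpos (add_natCast_mem_slitPlane _ he.pos hw) ?_ hz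
    have hd' : (0 : ℝ) < d := by exact_mod_cast hd.pos
    have := mul_pos hd' hw
    simp only [Int.cast_neg, Int.cast_natCast, neg_mul, Complex.add_im, Complex.neg_im,
      Complex.natCast_im, add_zero]
    rw [← Complex.ofReal_natCast, Complex.im_ofReal_mul]
    linarith
  rw [e1, eta_neg_inv hz] at hH
  rw [hH, ← hs, jacobiSym_cast_neg _ he, jacobiSym_cast_reciprocity he hd]
  have hexp : zeta24 ^ (6 * (e - 1) : ℤ) * zeta24 ^ etaExponent (-b) a (-d) e *
      zeta24 ^ (-3 : ℤ) = zeta24 ^ (3 * (e - 1) * (d - 1) : ℤ) * zeta24 ^ etaExponent a b e d := by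
    simp only [← zpow_add₀ zeta24_ne_zero]
    apply zeta24_zpow_congr
    obtain ⟨u, rfl⟩ := he
    -- Modulo the determinant relation the exponents differ by `12 (e - 1) = 24 u`.
    refine ⟨u, ?_⟩
    unfold etaExponent
    push_cast at h ⊢
    linear_combination (-(2 * u + 1) * d) * h
  linear_combination (jacobiSym d e : ℂ) * Complex.sqrt (((-d : ℤ) : ℂ) * (-1 / z) + e) *
    Complex.sqrt z * eta z * hexp

theorem EtaRule.of_inv_neg {a b : ℤ} {e d : ℕ} (he : Odd e) (hd : Odd d)
    (h : a * d + b * e = 1) (H : EtaRule b (-a) d e) : EtaRule a b (-e) d := by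
  intro z hz
  have h0 : z ≠ 0 := by rintro rfl; simp at hz
  have hw := neg_inv_im_pos hz
  have hx : (((d : ℤ) : ℂ) * (-1 / z) + e) * z = -(((-e : ℤ) : ℂ) * z + d) := by
    push_cast; field_simp; ring
  have hH := H _ hw
  have e1 : ((b : ℂ) * (-1 / z) + ((-a : ℤ) : ℂ)) / (((d : ℤ) : ℂ) * (-1 / z) + e) =
      (a * z + b) / (((-e : ℤ) : ℂ) * z + d) := by
    rw [← mul_div_mul_right _ _ h0, hx, ← neg_div_neg_eq, neg_neg]
    congr 1
    push_cast; field_simp; ring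
  have hs : Complex.sqrt (((d : ℤ) : ℂ) * (-1 / z) + e) * Complex.sqrt z =
      zeta24 ^ (6 : ℤ) * Complex.sqrt (((-e : ℤ) : ℂ) * z + d) := by
    have hd' : (0 : ℝ) < d := by exact_mod_cast hd.pos
    have := mul_pos hd' hw
    rw [Complex.sqrt_mul_sqrt_neg _ hz, hx, neg_neg, zeta24_zpow_six]
    simp only [Int.cast_natCast, Complex.add_im, Complex.natCast_im, add_zero]
    rwa [← Complex.ofReal_natCast, Complex.im_ofReal_mul]
  rw [e1, eta_neg_inv hz] at hH
  rw [hH, jacobiSym_cast_neg _ hd, jacobiSym_cast_reciprocity he hd]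
  have hexp : zeta24 ^ etaExponent b (-a) d e * zeta24 ^ (-3 : ℤ) * zeta24 ^ (6 : ℤ) =
      zeta24 ^ (6 * (d - 1) : ℤ) * zeta24 ^ (3 * (e - 1) * (d - 1) : ℤ) *
        zeta24 ^ etaExponent a b (-e) d := by
    simp only [← zpow_add₀ zeta24_ne_zero]
    apply zeta24_zpow_congr
    obtain ⟨u, rfl⟩ := he
    obtain ⟨v, rfl⟩ := hd
    refine ⟨-(v * (u + 1)), ?_⟩
    unfold etaExponent
    push_cast at h ⊢
    linear_combination ((2 * u + 1) * (2 * v + 1)) * h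
  linear_combination (jacobiSym d e : ℂ) * zeta24 ^ etaExponent b (-a) d e *
    zeta24 ^ (-3 : ℤ) * eta z * hs + (jacobiSym d e : ℂ) *
    Complex.sqrt (((-e : ℤ) : ℂ) * z + d) * eta z * hexp

theorem etaRule_one {a b c : ℤ} (h : a - b * c = 1) : EtaRule a b c 1 := by
  rw [← etaRule_add_mul_iff odd_one (by push_cast; linear_combination h) (-c)]
  intro z _
  have ha : a + -c * b = 1 := by linear_combination h
  have hc : c + -c * ((1 : ℕ) : ℤ) = 0 := by push_cast; ring
  rw [ha, hc]
  have hk : etaExponent 1 b 0 1 = b := by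
    unfold etaExponent
    ring
  simp [hk, eta_add_int]

/-- The residues `c % d` and `c % d - d` have opposite parity because `d` is odd. -/
theorem exists_odd_natAbs_lt {c : ℤ} {d : ℕ} (hd : Odd d) (h : ¬ (d : ℤ) ∣ c) :
    ∃ j : ℤ, Odd (c + j * d) ∧ (c + j * d).natAbs < d := by
  have hd0 : (0 : ℤ) < d := by exact_mod_cast hd.pos
  have h1 := Int.emod_nonneg c hd0.ne'
  have h2 := Int.emod_lt_of_pos c hd0
  have h3 : c % d ≠ 0 := fun h0 => h (Int.dvd_of_emod_eq_zero h0)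
  have e1 : c + -(c / d) * d = c % d := by rw [Int.emod_def]; ring
  rcases Int.even_or_odd (c % d) with hr | hr
  · have e2 : c + (-(c / d) - 1) * d = c % d - d := by rw [Int.emod_def]; ring
    refine ⟨-(c / d) - 1, ?_, ?_⟩
    · rw [e2]
      exact hr.sub_odd (by exact_mod_cast hd)
    · rw [e2]; omega
  · refine ⟨-(c / d), ?_, ?_⟩
    · rwa [e1]
    · rw [e1]; omega

/-- The eta multiplier of a matrix with odd positive lower right entry. -/
theorem etaRule {d : ℕ} (hd : Odd d) {a b c : ℤ} (h : a * d - b * c = 1) : EtaRule a b c d := by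
  induction d using Nat.strong_induction_on generalizing a b c with
  | _ d ih =>
    -- Descent: make `c` odd with `|c| < d`, then apply `S` so that `|c|` becomes the new lower
    -- right entry. Oddness of `c` keeps the induction among odd entries.
    rcases eq_or_ne d 1 with rfl | hd1
    · exact etaRule_one (by simpa using h)
    have hdvd : ¬ (d : ℤ) ∣ c := by
      rintro ⟨m, rfl⟩
      have : (d : ℤ) ∣ 1 := ⟨a - b * m, by linear_combination -h⟩
      exact hd1 (by exact_mod_cast Int.eq_one_of_dvd_one (by positivity) this)
    obtain ⟨j, hodd, hlt⟩ := exists_odd_natAbs_lt hd hdvd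
    rw [← etaRule_add_mul_iff hd h j]
    have h' : (a + j * b) * d - b * (c + j * d) = 1 := by linear_combination h
    generalize a + j * b = a' at h' ⊢
    generalize c + j * d = c' at h' hodd hlt ⊢
    obtain ⟨e, rfl | rfl⟩ := Int.eq_nat_or_neg c'
    · have he : Odd e := by exact_mod_cast hodd
      exact EtaRule.of_inv_pos he hd h' (ih e (by simpa using hlt) he (by linear_combination h'))
    · have he : Odd e := by simpa using hodd
      exact EtaRule.of_inv_neg he hd (by linear_combination h')
        (ih e (by simpa using hlt) he (by linear_combination h'))

/-! ### Invariance of eta quotients under `Γ₁(N)` -/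

/-- The eta quotient as a function on `ℂ`. -/
noncomputable def etaQuotientFun (N : ℕ) (r : ℕ → ℤ) (z : ℂ) : ℂ :=
  ∏ δ ∈ N.divisors, eta ((δ : ℂ) * z) ^ r δ

/-- Conjugation by `z ↦ δz` gives the matrix with rows `(a, δb)` and `(mc, d)`. The reciprocity
factor `3(m-1)(d-1)` makes the exponent linear in `m` and `δ`, as `δm² = Nm`. -/
theorem eta_natCast_mul_eq {N : ℕ} (hN : Odd N) {δ m d : ℕ} (hm : N = δ * m) (hd : Odd d)
    {a b c : ℤ} (h : a * d - b * (N * c) = 1) (hd1 : (N : ℤ) ∣ d - 1) {z : ℂ} (hz : 0 < z.im) :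
    eta (δ * ((a * z + b) / ((N * c : ℤ) * z + d))) =
      (jacobiSym c d : ℂ) * zeta24 ^ (m * ((a + d) * c - b * d * (N * c ^ 2) -
        3 * c * d + 3 * (d - 1)) + δ * (b * d) : ℤ) *
        Complex.sqrt ((N * c : ℤ) * z + d) * eta (δ * z) := by
  have hδ : 0 < δ := by
    rcases Nat.eq_zero_or_pos δ with rfl | h
    · simp [hm] at hN
    · exact h
  have hmo : Odd m := by
    rw [hm] at hN
    exact (Nat.odd_mul.mp hN).2
  have hδz : 0 < ((δ : ℂ) * z).im := by
    rw [← Complex.ofReal_natCast, Complex.im_ofReal_mul]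
    have : (0 : ℝ) < δ := by exact_mod_cast hδ
    positivity
  have hdet : a * d - (δ * b) * (m * c) = 1 := by
    rw [hm] at h
    push_cast at h
    linear_combination h
  have H := etaRule hd hdet _ hδz
  have e1 : ((m * c : ℤ) : ℂ) * (δ * z) + d = (N * c : ℤ) * z + d := by
    rw [hm]; push_cast; ring
  have e2 : ((a : ℂ) * (δ * z) + ((δ * b : ℤ) : ℂ)) / ((N * c : ℤ) * z + d) =
      δ * ((a * z + b) / ((N * c : ℤ) * z + d)) := by
    push_cast; ring
  rw [e1, e2] at H
  rw [H, jacobiSym.mul_left]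
  have hJ : jacobiSym d m = 1 := by
    rw [← jacobiSym.one_left m]
    apply jacobiSym.mod_left'
    refine Int.modEq_of_dvd ?_
    rw [← neg_sub, dvd_neg]
    exact (Int.natCast_dvd_natCast.mpr ⟨δ, by rw [hm, mul_comm]⟩).trans hd1
  push_cast
  rw [show ((jacobiSym (m : ℤ) d : ℤ) : ℂ) = _ from jacobiSym_cast_reciprocity hmo hd, hJ]
  have hexp : zeta24 ^ (3 * (m - 1) * (d - 1) : ℤ) * zeta24 ^ etaExponent a (δ * b) (m * c) d =
      zeta24 ^ (m * ((a + d) * c - b * d * (N * c ^ 2) -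
        3 * c * d + 3 * (d - 1)) + δ * (b * d) : ℤ) := by
    rw [← zpow_add₀ zeta24_ne_zero]
    congr 1
    unfold etaExponent
    rw [hm]
    push_cast
    ring
  push_cast
  linear_combination (jacobiSym c d : ℂ) * Complex.sqrt (N * c * z + d) * eta (δ * z) * hexp


theorem Finset.prod_const_zpow {ι K : Type*} [Field K] {x : K} (hx : x ≠ 0) (s : Finset ι)
    (r : ι → ℤ) : ∏ i ∈ s, x ^ r i = x ^ ∑ i ∈ s, r i := by
  classical
  induction s using Finset.induction_on with
  | empty => simp
  | insert i t hi ih => rw [prod_insert hi, sum_insert hi, ih, zpow_add₀ hx]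

theorem etaQuotientFun_moebius_of_odd {N : ℕ} (hN : Odd N) {r : ℕ → ℤ} {k : ℤ}
    (hk : ∑ δ ∈ N.divisors, r δ = 2 * k) (h1 : 24 ∣ ∑ δ ∈ N.divisors, δ * r δ)
    (h2 : 24 ∣ ∑ δ ∈ N.divisors, (N / δ : ℕ) * r δ) {d : ℕ} (hd : Odd d)
    {a b c : ℤ} (h : a * d - b * (N * c) = 1) (hd1 : (N : ℤ) ∣ d - 1) {z : ℂ} (hz : 0 < z.im) :
    etaQuotientFun N r ((a * z + b) / ((N * c : ℤ) * z + d)) =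
      ((N * c : ℤ) * z + d) ^ k * etaQuotientFun N r z := by
  set X : ℤ := (a + d) * c - b * d * (N * c ^ 2) - 3 * c * d + 3 * (d - 1) with hX
  set s := Complex.sqrt ((N * c : ℤ) * z + d) with hs
  have hs0 : s ≠ 0 := by
    have := Complex.sqrt_re_pos (add_natCast_mem_slitPlane (N * c) hd.pos hz)
    intro h
    rw [← hs, h] at this
    simp at this
  have hs2 : s ^ (2 : ℤ) = (N * c : ℤ) * z + d := by
    rw [← Complex.sqrt_pow_two ((N * c : ℤ) * z + d)]
    norm_cast
  have hJ : (jacobiSym c d : ℂ) ^ (2 : ℤ) = 1 := by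
    have : c.gcd d = 1 := Int.isCoprime_iff_gcd_eq_one.mp ⟨-(b * N), a, by linear_combination h⟩
    exact_mod_cast jacobiSym.sq_one this
  have hJ0 : (jacobiSym c d : ℂ) ≠ 0 := by
    intro h
    rw [h] at hJ
    norm_num at hJ
  have hterm : ∀ δ ∈ N.divisors, eta (δ * ((a * z + b) / ((N * c : ℤ) * z + d))) ^ r δ =
      (jacobiSym c d : ℂ) ^ r δ * zeta24 ^ (X * ((N / δ : ℕ) * r δ) + b * d * (δ * r δ)) *
        s ^ r δ * eta (δ * z) ^ r δ := by
    intro δ hδ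
    rw [eta_natCast_mul_eq hN (Nat.mul_div_cancel' (Nat.dvd_of_mem_divisors hδ)).symm hd h hd1 hz,
      mul_zpow, mul_zpow, mul_zpow, ← zpow_mul]
    congr 4
    rw [hX]
    ring
  have hprod : ∀ x : ℂ, x ≠ 0 → ∏ δ ∈ N.divisors, x ^ r δ = (x ^ (2 : ℤ)) ^ k := by
    intro x hx
    rw [← zpow_mul, ← hk]
    exact Finset.prod_const_zpow hx _ _
  unfold etaQuotientFun
  rw [Finset.prod_congr rfl hterm]
  simp only [Finset.prod_mul_distrib]
  rw [hprod _ hJ0, hprod _ hs0, hJ, hs2, one_zpow, one_mul,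
    Finset.prod_const_zpow zeta24_ne_zero, zeta24_zpow_of_dvd, one_mul]
  rw [Finset.sum_add_distrib, ← Finset.mul_sum, ← Finset.mul_sum]
  exact dvd_add (h2.mul_left _) (h1.mul_left _)

/-- Taking `j` to be a large multiple of `c` forces positivity. If the result is even, coprimality
makes `c` odd, and adding `c²` flips the parity. -/
theorem exists_odd_add_mul {c d : ℤ} (hc : c ≠ 0) (hcop : IsCoprime c d) :
    ∃ j : ℤ, Odd (d + j * c) ∧ 0 < d + j * c := by
  have hc1 : 1 ≤ c * c := by
    have : 0 < c * c := mul_self_pos.mpr hc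
    omega
  have hd := neg_abs_le d
  have habs := abs_nonneg d
  have hpos : ∀ t : ℤ, |d| + 1 ≤ t → 0 < d + (t * c) * c := fun t ht => by nlinarith
  by_cases ho : Odd (d + ((|d| + 1) * c) * c)
  · exact ⟨_, ho, hpos _ le_rfl⟩
  · refine ⟨(|d| + 1 + 1) * c, ?_, hpos _ (by omega)⟩
    rw [Int.not_odd_iff_even] at ho
    have hco : Odd c := by
      by_contra hce
      rw [Int.not_odd_iff_even] at hce
      have hde : Even d := by
        have := (Int.even_add.mp ho).mpr (hce.mul_left _)
        exact this
      exact absurd (hcop.isUnit_of_dvd' hce.two_dvd hde.two_dvd) (by decide)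
    rw [show d + ((|d| + 1 + 1) * c) * c = d + ((|d| + 1) * c) * c + c * c by ring]
    exact ho.add_odd (hco.mul hco)

theorem etaQuotientFun_moebius {N : ℕ} (hN : Odd N) {r : ℕ → ℤ} {k : ℤ}
    (hk : ∑ δ ∈ N.divisors, r δ = 2 * k) (h1 : 24 ∣ ∑ δ ∈ N.divisors, δ * r δ)
    (h2 : 24 ∣ ∑ δ ∈ N.divisors, (N / δ : ℕ) * r δ)
    {a b c d : ℤ} (h : a * d - b * c = 1) (hc : (N : ℤ) ∣ c) (hd1 : (N : ℤ) ∣ d - 1) {z : ℂ}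
    (hz : 0 < z.im) :
    etaQuotientFun N r ((a * z + b) / (c * z + d)) = (c * z + d) ^ k * etaQuotientFun N r z := by
  have hone : ∀ (a b : ℤ), a = 1 → ∀ z : ℂ, 0 < z.im →
      etaQuotientFun N r (a * z + b) = etaQuotientFun N r z := by
    rintro a b rfl z hz
    simpa using etaQuotientFun_moebius_of_odd hN hk h1 h2 odd_one
      (a := 1) (b := b) (c := 0) (by simp) (by simp) hz
  rcases eq_or_ne c 0 with rfl | hc0
  · rcases Int.eq_one_or_neg_one_of_mul_eq_one (show d * a = 1 by linear_combination h) with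
      rfl | rfl
    · simpa using hone a b (by linear_combination h) z hz
    -- Lower right entry `-1` forces `N ∣ 2`, so `N = 1`; then `r 1 = 2k` is divisible by 24 and the
    -- sign `(-1)^k` is trivial.
    · have hN1 : N = 1 := by
        have h2 : N ∣ 2 := by
          rw [← Int.natCast_dvd_natCast, ← dvd_neg]
          simpa using hd1
        rcases (Nat.dvd_prime Nat.prime_two).mp h2 with h | rfl
        · exact h
        · exact absurd hN (by decide)
      have hke : Even k := by
        subst hN1
        simp only [Nat.divisors_one, Finset.sum_singleton] at hk h1
        rw [hk] at h1
        rw [Int.even_iff]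
        omega
      have := hone (-a) (-b) (by linear_combination h) z hz
      simp only [Int.cast_zero, zero_mul, zero_add, Int.cast_neg, Int.cast_one, hke.neg_one_zpow,
        one_mul] at this ⊢
      rw [← this]
      congr 1
      ring
  · have hcop : IsCoprime c d := ⟨-b, a, by linear_combination h⟩
    obtain ⟨j, hodd, hpos⟩ := exists_odd_add_mul hc0 hcop
    obtain ⟨c', rfl⟩ := hc
    obtain ⟨e, he⟩ := Int.eq_ofNat_of_zero_le hpos.le
    have hz' : 0 < (z - j).im := by simpa using hz
    have heo : Odd e := by
      rw [he] at hodd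
      exact_mod_cast hodd
    -- Write `γ z = (γ Tʲ)(z - j)`; the factor `Tʲ` leaves `c` fixed and makes the lower right entry
    -- odd and positive.
    have H := etaQuotientFun_moebius_of_odd hN hk h1 h2 heo (a := a) (b := b + j * a) (c := c')
      (by rw [← he]; linear_combination h)
      (by
        rw [← he, show d + j * (N * c') - 1 = d - 1 + N * (j * c') by ring]
        exact dvd_add hd1 (dvd_mul_right _ _)) hz'
    have heC : (e : ℂ) = d + j * (N * c') := by
      have := congrArg (Int.cast : ℤ → ℂ) he
      push_cast at this
      exact this.symm
    have e1 : ((N * c' : ℤ) : ℂ) * (z - j) + e = (N * c' : ℤ) * z + d := by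
      rw [heC]; push_cast; ring
    have e2 : (a : ℂ) * (z - j) + ((b + j * a : ℤ) : ℂ) = a * z + b := by
      push_cast; ring
    have e3 : etaQuotientFun N r (z - j) = etaQuotientFun N r z := by
      have := hone 1 (-j) rfl z hz
      push_cast at this
      rwa [one_mul, ← sub_eq_add_neg] at this
    rwa [e1, e2, e3] at H

theorem coe_SL2Z_smul (γ : SL(2, ℤ)) (z : ℍ) :
    ((γ • z : ℍ) : ℂ) = (γ 0 0 * z + γ 0 1) / (γ 1 0 * z + γ 1 1) := by
  rw [UpperHalfPlane.specialLinearGroup_apply]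
  simp

theorem SL2Z_det_eq (γ : SL(2, ℤ)) : γ 0 0 * γ 1 1 - γ 0 1 * γ 1 0 = 1 := by
  rw [← Matrix.det_fin_two, γ.det_coe]

theorem etaQuotient_slash {N : ℕ} (hN : Odd N) {r : ℕ → ℤ} {k : ℤ}
    (hk : ∑ δ ∈ N.divisors, r δ = 2 * k) (h1 : 24 ∣ ∑ δ ∈ N.divisors, δ * r δ)
    (h2 : 24 ∣ ∑ δ ∈ N.divisors, (N / δ : ℕ) * r δ) {γ : SL(2, ℤ)} (hγ : γ ∈ Gamma1 N) :
    etaQuotient N r ∣[k] γ = etaQuotient N r := by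
  obtain ⟨-, h11, h10⟩ := (Gamma1_mem N γ).mp hγ
  ext z
  rw [slash_action_eq'_iff]
  have hc : (N : ℤ) ∣ γ 1 0 := (ZMod.intCast_zmod_eq_zero_iff_dvd _ N).mp h10
  have hd : (N : ℤ) ∣ γ 1 1 - 1 := by
    rw [← ZMod.intCast_zmod_eq_zero_iff_dvd]
    push_cast
    rw [h11, sub_self]
  have H := etaQuotientFun_moebius hN hk h1 h2 (SL2Z_det_eq γ) hc hd z.2
  show etaQuotientFun N r ((γ • z : ℍ) : ℂ) = _ * etaQuotientFun N r z
  rw [coe_SL2Z_smul]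
  exact H

/-! ### Holomorphic functions of `q` and meromorphy at the cusps -/

/-- Functions of the form `q ^ m * G q`, `q = exp (2 π i z / h)`, where `G` is holomorphic without
zeros on the unit disc. -/
def IsQMonomialMulUnit (h : ℕ) (g : ℍ → ℂ) : Prop :=
  ∃ (m : ℤ) (G : ℂ → ℂ), DifferentiableOn ℂ G (Metric.ball 0 1) ∧
    (∀ q ∈ Metric.ball (0 : ℂ) 1, G q ≠ 0) ∧
    ∀ z : ℍ, g z = Function.Periodic.qParam h z ^ m * G (Function.Periodic.qParam h z)

namespace IsQMonomialMulUnit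

theorem const {h : ℕ} {c : ℂ} (hc : c ≠ 0) : IsQMonomialMulUnit h fun _ => c :=
  ⟨0, fun _ => c, by fun_prop, fun _ _ => hc, fun z => by simp⟩

theorem mul {h : ℕ} {f g : ℍ → ℂ} (hf : IsQMonomialMulUnit h f) (hg : IsQMonomialMulUnit h g) :
    IsQMonomialMulUnit h fun z => f z * g z := by
  obtain ⟨m, F, hF, hF0, hf⟩ := hf
  obtain ⟨n, G, hG, hG0, hg⟩ := hg
  refine ⟨m + n, fun q => F q * G q, hF.mul hG, fun q hq => mul_ne_zero (hF0 q hq) (hG0 q hq),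
    fun z => ?_⟩
  dsimp only
  rw [hf, hg, zpow_add₀ (Function.Periodic.qParam_ne_zero _)]
  ring

theorem zpow {h : ℕ} {f : ℍ → ℂ} (hf : IsQMonomialMulUnit h f) (n : ℤ) :
    IsQMonomialMulUnit h fun z => f z ^ n := by
  obtain ⟨m, F, hF, hF0, hf⟩ := hf
  refine ⟨m * n, fun q => F q ^ n, fun q hq => (hF q hq).zpow (Or.inl (hF0 q hq)),
    fun q hq => zpow_ne_zero _ (hF0 q hq), fun z => ?_⟩
  dsimp only
  rw [hf, mul_zpow, zpow_mul]

theorem prod {h : ℕ} {ι : Type*} {s : Finset ι} {f : ι → ℍ → ℂ}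
    (hf : ∀ i ∈ s, IsQMonomialMulUnit h (f i)) : IsQMonomialMulUnit h fun z => ∏ i ∈ s, f i z := by
  classical
  induction s using Finset.induction_on with
  | empty => simpa using const one_ne_zero
  | insert i t hi ih =>
    simp only [Finset.prod_insert hi]
    exact (hf i (Finset.mem_insert_self i t)).mul
      (ih fun j hj => hf j (Finset.mem_insert_of_mem hj))

theorem qParam_mem_ball {h : ℕ} (hh : 0 < h) (z : ℍ) :
    Function.Periodic.qParam (h : ℝ) (z : ℂ) ∈ Metric.ball (0 : ℂ) 1 := by
  rw [mem_ball_zero_iff]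
  exact Function.Periodic.norm_qParam_lt_one (by exact_mod_cast hh) z.2

theorem ne_zero {h : ℕ} (hh : 0 < h) {f : ℍ → ℂ} (hf : IsQMonomialMulUnit h f) (z : ℍ) :
    f z ≠ 0 := by
  obtain ⟨m, F, -, hF0, hf⟩ := hf
  rw [hf]
  exact mul_ne_zero (zpow_ne_zero _ (Function.Periodic.qParam_ne_zero _))
    (hF0 _ (qParam_mem_ball hh z))

theorem continuous {h : ℕ} (hh : 0 < h) {f : ℍ → ℂ} (hf : IsQMonomialMulUnit h f) :
    Continuous f := by
  obtain ⟨m, F, hF, -, hf⟩ := hf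
  have hq : Continuous fun z : ℍ => Function.Periodic.qParam (h : ℝ) (z : ℂ) :=
    Function.Periodic.continuous_qParam.comp UpperHalfPlane.continuous_coe
  rw [funext hf]
  exact (hq.zpow₀ m fun z => Or.inl (Function.Periodic.qParam_ne_zero _)).mul
    (hF.continuousOn.comp_continuous hq (qParam_mem_ball hh))

theorem meromorphicAtImInfty {h : ℕ} (hh : 0 < h) {f : ℍ → ℂ} (hf : IsQMonomialMulUnit h f) :
    MeromorphicAtImInfty f := by
  obtain ⟨m, F, hF, -, hf⟩ := hf
  refine ⟨h, hh, fun n => if m ≤ n then ((n - m).toNat.factorial : ℂ)⁻¹ *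
    iteratedDeriv (n - m).toNat F 0 else 0, m, fun n hn => if_neg (not_le.mpr hn), fun z => ?_⟩
  have hq0 := Function.Periodic.qParam_ne_zero (h := (h : ℝ)) (z : ℂ)
  have hq1 := qParam_mem_ball hh z
  have hinj : Function.Injective (fun j : ℕ => (j : ℤ) + m) := fun i j hij => by
    simpa using hij
  rw [← hinj.hasSum_iff]
  · have H := (Complex.hasSum_taylorSeries_on_ball hF hq1).mul_left
      (Function.Periodic.qParam (h : ℝ) (z : ℂ) ^ m)
    rw [← hf] at H
    refine Eq.mpr (congrArg (fun u : ℕ → ℂ => HasSum u (f z)) (funext fun j => ?_)) H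
    simp only [Function.comp_apply, le_add_iff_nonneg_left, Int.natCast_nonneg, if_true,
      add_sub_cancel_right, Int.toNat_natCast, sub_zero, smul_eq_mul, zpow_add₀ hq0, zpow_natCast]
    ring
  · intro n hn
    have : ¬ m ≤ n := fun hmn => hn ⟨(n - m).toNat, by
      show ((n - m).toNat : ℤ) + m = n
      omega⟩
    simp [this]

end IsQMonomialMulUnit

theorem isQMonomialMulUnit_eta {N A m : ℕ} (hN : 0 < N) (hA : 0 < A) (hm : 0 < m) (B : ℤ) :
    IsQMonomialMulUnit (24 * N) fun z => eta ((A * z + B) * m / N) := by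
  have hNC : (N : ℂ) ≠ 0 := by exact_mod_cast hN.ne'
  set c₁ : ℂ := Function.Periodic.qParam (24 : ℝ) ((B : ℂ) * m / N) with hc₁
  set c₂ : ℂ := Function.Periodic.qParam (1 : ℝ) ((B : ℂ) * m / N) with hc₂
  have hnorm : ‖c₂‖ = 1 := by
    have : ((B : ℂ) * m / N) = (((B : ℝ) * m / N : ℝ) : ℂ) := by push_cast; rfl
    rw [hc₂, Function.Periodic.norm_qParam, this, Complex.ofReal_im]
    simp
  have hball : ∀ q ∈ Metric.ball (0 : ℂ) 1, c₂ * q ^ (24 * (A * m)) ∈ Metric.ball (0 : ℂ) 1 := by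
    intro q hq
    rw [mem_ball_zero_iff] at hq ⊢
    rw [norm_mul, hnorm, one_mul, norm_pow]
    exact pow_lt_one₀ (norm_nonneg _) hq (by positivity)
  refine ⟨(A * m : ℕ), fun q => c₁ * ∏' n : ℕ, (1 - (c₂ * q ^ (24 * (A * m))) ^ (n + 1)), ?_, ?_, ?_⟩
  · exact (differentiableOn_tprod_one_sub_pow.comp (f := fun q => c₂ * q ^ (24 * (A * m)))
      (by fun_prop) hball).const_mul c₁
  · intro q hq
    have hx := hball q hq
    rw [mem_ball_zero_iff] at hx
    show c₁ * ∏' n : ℕ, (1 - (c₂ * q ^ (24 * (A * m))) ^ (n + 1)) ≠ 0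
    generalize c₂ * q ^ (24 * (A * m)) = x at hx ⊢
    refine mul_ne_zero (Function.Periodic.qParam_ne_zero _) ?_
    simp only [sub_eq_add_neg]
    refine tprod_one_add_ne_zero_of_summable (f := fun n => -x ^ (n + 1)) (fun n => ?_) ?_
    · rw [← sub_eq_add_neg, sub_ne_zero]
      intro h
      have h2 : ‖x ^ (n + 1)‖ < 1 := by
        rw [norm_pow]
        exact pow_lt_one₀ (norm_nonneg _) hx (by positivity)
      rw [← h] at h2
      simp at h2
    · simpa using (summable_nat_add_iff 1).mpr (summable_geometric_of_lt_one (norm_nonneg _) hx)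
  · intro z
    have e24 : Function.Periodic.qParam (24 : ℝ) ((A * z + B) * m / N) =
        c₁ * Function.Periodic.qParam ((24 * N : ℕ) : ℝ) z ^ (A * m) := by
      rw [hc₁]
      simp only [Function.Periodic.qParam, ← Complex.exp_nat_mul, ← Complex.exp_add]
      congr 1
      push_cast
      field_simp
      ring
    have e1 : Function.Periodic.qParam (1 : ℝ) ((A * z + B) * m / N) =
        c₂ * Function.Periodic.qParam ((24 * N : ℕ) : ℝ) z ^ (24 * (A * m)) := by
      rw [hc₂]
      simp only [Function.Periodic.qParam, ← Complex.exp_nat_mul, ← Complex.exp_add]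
      congr 1
      push_cast
      field_simp
      ring
    simp only [eta, eta_q, e24, e1, zpow_natCast]
    ring

/-! ### Eta quotients at the cusps -/

/-- The continuous quotient `f/g` takes values in the finite set of `n`-th roots of `c`, so it is
constant on a connected space. -/
theorem exists_eq_const_mul_of_pow_eq {X : Type*} [TopologicalSpace X] [PreconnectedSpace X]
    [Nonempty X] {f g : X → ℂ} (hf : Continuous f) (hg : Continuous g) (hg0 : ∀ x, g x ≠ 0)
    {n : ℕ} (hn : 0 < n) {c : ℂ} (h : ∀ x, f x ^ n = c * g x ^ n) :
    ∃ c' : ℂ, ∀ x, f x = c' * g x := by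
  have hfin : {x : ℂ | x ^ n = c}.Finite := by
    refine (Polynomial.nthRoots n c).toFinset.finite_toSet.subset fun x hx => ?_
    simpa [Polynomial.mem_nthRoots hn] using hx
  obtain ⟨y⟩ := ‹Nonempty X›
  refine ⟨f y / g y, fun x => ?_⟩
  have := isPreconnected_univ.constant_of_mapsTo hfin.isDiscrete
    (f := fun x => f x / g x) (hf.div hg hg0).continuousOn
    (fun x _ => by
      show (f x / g x) ^ n = c
      rw [div_pow, h, mul_div_cancel_right₀ _ (pow_ne_zero _ (hg0 x))])
    (Set.mem_univ y) (Set.mem_univ x)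
  rw [this, div_mul_cancel₀ _ (hg0 x)]

theorem eta_pow_moebius (γ : SL(2, ℤ)) (z : ℍ) :
    eta ((γ • z : ℍ) : ℂ) ^ 24 = (γ 1 0 * z + γ 1 1) ^ 12 * eta z ^ 24 := by
  have h := SlashInvariantForm.slash_action_generators_SL2Z
    discriminant_S_invariant discriminant_T_invariant γ
  have := (slash_action_eq'_iff _ _ _ _).mp (congrFun h z)
  exact_mod_cast this

/-- Hermite normal form: `diag(δ, 1) γ = γ' (A B; 0 D)` with `γ'` in `SL(2, ℤ)`. The first column of
`γ'` is `(δa, c)` divided by its gcd `A`, completed by Bézout coefficients; then modularity of `η²⁴`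
applies to `γ'`. -/
theorem exists_eta_natCast_mul_smul {δ : ℕ} (hδ : 0 < δ) (γ : SL(2, ℤ)) :
    ∃ (A D : ℕ) (B : ℤ), 0 < A ∧ A * D = δ ∧ ∀ z : ℍ,
      eta (δ * ((γ • z : ℍ) : ℂ)) ^ 24 =
        ((γ 1 0 * z + γ 1 1) / D) ^ 12 * eta ((A * z + B) / D) ^ 24 := by
  have hdet := SL2Z_det_eq γ
  set a := γ 0 0
  set b := γ 0 1
  set c := γ 1 0
  set d := γ 1 1
  have hA : 0 < Int.gcd (δ * a) c := by
    rw [Int.gcd_pos_iff]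
    by_contra! h
    obtain ⟨h1, h2⟩ := h
    have h3 : a = 0 := by simpa [hδ.ne'] using h1
    rw [h3, h2] at hdet
    simp at hdet
  set A := Int.gcd (δ * a) c with hAdef
  obtain ⟨α, hα⟩ : (A : ℤ) ∣ δ * a := Int.gcd_dvd_left ..
  obtain ⟨κ, hκ⟩ : (A : ℤ) ∣ c := Int.gcd_dvd_right ..
  have hA' : (A : ℤ) ≠ 0 := by exact_mod_cast hA.ne'
  have hbez := Int.gcd_eq_gcd_ab (δ * a) c
  rw [← hAdef] at hbez
  set u := Int.gcdA (δ * a) c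
  set v := Int.gcdB (δ * a) c
  have huv : α * u - (-v) * κ = 1 := by
    apply mul_left_cancel₀ hA'
    linear_combination u * hα.symm + v * hκ.symm - hbez
  have hAD : (A : ℤ) * (α * d - κ * δ * b) = δ := by
    linear_combination δ * hdet - d * hα + δ * b * hκ
  have hDpos : 0 < α * d - κ * δ * b := by
    have : 0 < (A : ℤ) * (α * d - κ * δ * b) := by rw [hAD]; exact_mod_cast hδ
    exact pos_of_mul_pos_right this (by positivity)
  obtain ⟨D, hD⟩ := Int.eq_ofNat_of_zero_le hDpos.le
  have hD0 : 0 < D := by rw [hD] at hDpos; exact_mod_cast hDpos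
  rw [hD] at hAD
  let γ' : SL(2, ℤ) := ⟨!![α, -v; κ, u], by rw [Matrix.det_fin_two_of]; linear_combination huv⟩
  set B : ℤ := u * (δ * b) + v * d with hB
  have hB1 : α * B - v * D = δ * b := by
    rw [hB, ← hD]
    linear_combination (δ * b) * huv
  have hB2 : κ * B + u * D = d := by
    rw [hB, ← hD]
    linear_combination d * huv
  refine ⟨A, D, B, hA, by exact_mod_cast hAD, fun z => ?_⟩
  have hDR : (0 : ℝ) < D := by exact_mod_cast hD0
  have hDC : (D : ℂ) ≠ 0 := by exact_mod_cast hD0.ne'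
  have hw : 0 < ((A * z + B) / D : ℂ).im := by
    have hAR : (0 : ℝ) < A := by exact_mod_cast hA
    have := z.im_pos
    rw [Complex.div_natCast_im]
    have : 0 < (A : ℝ) * z.im := by positivity
    simpa using div_pos this hDR
  have hden : (κ : ℂ) * ((A * z + B) / D) + u = (c * z + d) / D := by
    have h1 : (c : ℂ) = A * κ := by exact_mod_cast congrArg (Int.cast : ℤ → ℂ) hκ
    have h2 : (κ : ℂ) * B + u * D = d := by exact_mod_cast congrArg (Int.cast : ℤ → ℂ) hB2
    rw [h1, ← h2]
    field_simp
    ring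
  have hnum : (α : ℂ) * ((A * z + B) / D) + (-v : ℤ) = δ * (a * z + b) / D := by
    have h1 : (δ : ℂ) * a = A * α := by exact_mod_cast congrArg (Int.cast : ℤ → ℂ) hα
    have h2 : (α : ℂ) * B - v * D = δ * b := by exact_mod_cast congrArg (Int.cast : ℤ → ℂ) hB1
    rw [mul_add, ← mul_assoc, h1, ← h2]
    push_cast
    field_simp
    ring
  have H := eta_pow_moebius γ' ⟨_, hw⟩
  rw [coe_SL2Z_smul] at H
  have e1 : γ' 0 0 = α := rfl
  have e2 : γ' 0 1 = -v := rfl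
  have e3 : γ' 1 0 = κ := rfl
  have e4 : γ' 1 1 = u := rfl
  rw [e1, e2, e3, e4] at H
  simp only at H
  rw [hden, hnum, div_div_div_cancel_right₀ hDC] at H
  rw [coe_SL2Z_smul, ← mul_div_assoc]
  exact H

theorem natCast_mul_im_pos {δ : ℕ} (hδ : 0 < δ) (z : ℍ) : 0 < ((δ : ℂ) * (z : ℂ)).im := by
  have h1 : (0 : ℝ) < δ := by exact_mod_cast hδ
  have := mul_pos h1 z.im_pos
  simpa using this

theorem etaQuotient_mdifferentiable (N : ℕ) (r : ℕ → ℤ) :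
    MDifferentiable 𝓘(ℂ) 𝓘(ℂ) (etaQuotient N r) := by
  rw [UpperHalfPlane.mdifferentiable_iff]
  have : DifferentiableOn ℂ (etaQuotientFun N r) upperHalfPlaneSet := by
    refine DifferentiableOn.fun_finsetProd fun δ hδ z hz => ?_
    have him := natCast_mul_im_pos (Nat.pos_of_mem_divisors hδ) ⟨z, hz⟩
    refine DifferentiableWithinAt.zpow ?_ (Or.inl (eta_ne_zero him))
    exact ((differentiableAt_eta_of_mem_upperHalfPlaneSet him).comp z
      (by fun_prop)).differentiableWithinAt
  refine this.congr fun z hz => ?_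
  rw [Function.comp_apply, ofComplex_apply_of_im_pos hz]
  rfl

theorem etaQuotient_slash_meromorphicAtImInfty {N : ℕ} (hN : 0 < N) {r : ℕ → ℤ} {k : ℤ}
    (hk : ∑ δ ∈ N.divisors, r δ = 2 * k) (γ : SL(2, ℤ)) :
    MeromorphicAtImInfty (etaQuotient N r ∣[k] γ) := by
  choose! A D B hA hAD hη using
    fun (δ : ℕ) (hδ : 0 < δ) => exists_eta_natCast_mul_smul hδ γ
  set G : ℍ → ℂ := fun z => ∏ δ ∈ N.divisors, eta ((A δ * z + B δ) / D δ) ^ r δ with hG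
  have hGq : IsQMonomialMulUnit (24 * N) G := by
    refine IsQMonomialMulUnit.prod fun δ hδ => IsQMonomialMulUnit.zpow ?_ _
    have hδ0 := Nat.pos_of_mem_divisors hδ
    have hDN : D δ ∣ N := (Dvd.intro_left _ (hAD δ hδ0)).trans (Nat.dvd_of_mem_divisors hδ)
    obtain ⟨m, hm⟩ := hDN
    have hm0 : 0 < m := Nat.pos_of_ne_zero (by rintro rfl; omega)
    have hD0 : 0 < D δ := Nat.pos_of_ne_zero (by intro h; rw [h] at hm; omega)
    have := isQMonomialMulUnit_eta hN (hA δ hδ0) hm0 (B δ)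
    convert this using 3 with z
    have h1 : (D δ : ℂ) ≠ 0 := by exact_mod_cast hD0.ne'
    have h2 : (m : ℂ) ≠ 0 := by exact_mod_cast hm0.ne'
    rw [show (N : ℂ) = D δ * m by rw [← Nat.cast_mul, ← hm], mul_div_mul_right _ _ h2]
  have hG0 := hGq.ne_zero (by positivity)
  have hcontG := hGq.continuous (by positivity)
  have hcontF : Continuous (etaQuotient N r ∣[k] γ) := by
    have hc := (etaQuotient_mdifferentiable N r).continuous
    rw [SL_slash_def]
    have hγ : Continuous fun z : ℍ => γ • z :=
      continuous_const_smul (Matrix.SpecialLinearGroup.mapGL ℝ γ)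
    refine (hc.comp hγ).mul ?_
    refine Continuous.zpow₀ ?_ _ fun z => Or.inl (denom_ne_zero _ z)
    simp only [UpperHalfPlane.denom]
    fun_prop
  -- The factors `(cz + d)^(12 r_δ)` multiply to weight `24k`, which cancels the slash factor.
  have hpow : ∀ z, (etaQuotient N r ∣[k] γ) z ^ 24 =
      (∏ δ ∈ N.divisors, (((D δ : ℂ) ^ 12)⁻¹) ^ r δ) * G z ^ 24 := by
    intro z
    set j : ℂ := γ 1 0 * z + γ 1 1 with hj
    have hj0 : j ≠ 0 := by
      have := denom_ne_zero γ z
      rwa [ModularGroup.denom_apply] at this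
    have hterm : ∀ δ ∈ N.divisors, (eta (δ * ((γ • z : ℍ) : ℂ)) ^ r δ) ^ 24 =
        (j ^ 12) ^ r δ * (((D δ : ℂ) ^ 12)⁻¹) ^ r δ * (eta ((A δ * z + B δ) / D δ) ^ r δ) ^ 24 := by
      intro δ hδ
      have hcomm : ∀ x : ℂ, (x ^ r δ) ^ 24 = (x ^ 24) ^ r δ := fun x => by
        rw [← zpow_natCast, ← zpow_natCast, ← zpow_mul, ← zpow_mul, mul_comm]
      rw [hcomm, hcomm, hη δ (Nat.pos_of_mem_divisors hδ), mul_zpow, div_pow, div_eq_mul_inv,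
        mul_zpow]
    rw [SL_slash_apply, ModularGroup.denom_apply, ← hj, mul_pow, etaQuotient, ← Finset.prod_pow,
      Finset.prod_congr rfl hterm, Finset.prod_mul_distrib, Finset.prod_mul_distrib,
      Finset.prod_const_zpow (pow_ne_zero _ hj0), hk, hG, ← Finset.prod_pow]
    have hcancel : (j ^ 12) ^ (2 * k) * (j ^ (-k)) ^ 24 = 1 := by
      rw [← zpow_natCast, ← zpow_natCast, ← zpow_mul, ← zpow_mul, ← zpow_add₀ hj0]
      push_cast
      ring_nf
      simp
    linear_combination (∏ δ ∈ N.divisors, (((D δ : ℂ) ^ 12)⁻¹) ^ r δ) *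
      (∏ δ ∈ N.divisors, (eta ((A δ * z + B δ) / D δ) ^ r δ) ^ 24) * hcancel
  obtain ⟨c, hc⟩ := exists_eq_const_mul_of_pow_eq hcontF hcontG hG0 (by norm_num) hpow
  have hq := (hGq.meromorphicAtImInfty (by positivity)).smul c
  convert hq using 1
  exact funext hc

/-! ### Existence of suitable exponents -/

/-- With `N = δm`, one has `Nm = δm² ≡ δ mod n`. -/
theorem sum_divisors_mul_congr {N : ℕ} {n : ℤ} (r : ℕ → ℤ)
    (hsq : ∀ m : ℕ, m ∣ N → n ∣ (m : ℤ) ^ 2 - 1)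
    (h : n ∣ ∑ δ ∈ N.divisors, (N / δ : ℕ) * r δ) : n ∣ ∑ δ ∈ N.divisors, δ * r δ := by
  have : ∑ δ ∈ N.divisors, (δ : ℤ) * r δ = N * ∑ δ ∈ N.divisors, (N / δ : ℕ) * r δ -
      ∑ δ ∈ N.divisors, δ * r δ * (((N / δ : ℕ) : ℤ) ^ 2 - 1) := by
    rw [Finset.mul_sum, ← Finset.sum_sub_distrib]
    refine Finset.sum_congr rfl fun δ hδ => ?_
    have hm : (N : ℤ) = δ * (N / δ : ℕ) := by
      exact_mod_cast (Nat.mul_div_cancel' (Nat.dvd_of_mem_divisors hδ)).symm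
    generalize ((N / δ : ℕ) : ℤ) = m at hm ⊢
    rw [hm]
    ring
  rw [this]
  refine dvd_sub (h.mul_left _) (Finset.dvd_sum fun δ hδ => (hsq _ ?_).mul_left _)
  exact Nat.div_dvd_of_dvd (Nat.dvd_of_mem_divisors hδ)

theorem exists_exponents_of_gcd_dvd {N : ℕ} (hN : 0 < N) {k : ℤ}
    (hk : ((Nat.gcd (N.properDivisors.gcd fun δ => N / δ - 1) 24 : ℕ) : ℤ) ∣ 2 * k) :
    ∃ r : ℕ → ℤ, ∑ δ ∈ N.divisors, r δ = 2 * k ∧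
      24 ∣ ∑ δ ∈ N.divisors, (N / δ : ℕ) * r δ := by
  obtain ⟨g, hg⟩ := Finset.gcd_eq_sum_mul N.properDivisors fun δ => ((N / δ - 1 : ℕ) : ℤ)
  have hcast : (N.properDivisors.gcd fun δ => ((N / δ - 1 : ℕ) : ℤ)) ∣
      ((N.properDivisors.gcd fun δ => N / δ - 1 : ℕ) : ℤ) := by
    rw [← Int.natAbs_dvd, Int.natCast_dvd_natCast]
    exact Finset.dvd_gcd fun δ hδ => by
      simpa using Int.natAbs_dvd_natAbs.mpr
        (Finset.gcd_dvd (f := fun δ => ((N / δ - 1 : ℕ) : ℤ)) hδ)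
  set G := N.properDivisors.gcd fun δ => N / δ - 1
  obtain ⟨t, ht⟩ := hcast
  obtain ⟨w, hw⟩ := hk
  have hbez := Nat.gcd_eq_gcd_ab G 24
  set x := Nat.gcdA G 24
  set y := Nat.gcdB G 24
  set s : ℕ → ℤ := fun δ => g δ * t * x * w with hs
  have hsum : ∑ δ ∈ N.properDivisors, ((N / δ - 1 : ℕ) : ℤ) * s δ = 2 * k - 24 * (y * w) := by
    have : ∑ δ ∈ N.properDivisors, ((N / δ - 1 : ℕ) : ℤ) * s δ = G * x * w := by
      rw [ht, hg, Finset.sum_mul, Finset.sum_mul, Finset.sum_mul]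
      exact Finset.sum_congr rfl fun δ _ => by rw [hs]; ring
    rw [this, hw, hbez]
    push_cast
    ring
  have hNn : N ∉ N.properDivisors := Nat.self_notMem_properDivisors
  -- At `δ = N` the coefficient `N/δ - 1` vanishes, so `r_N` can correct the total without
  -- disturbing the congruence.
  refine ⟨fun δ => if δ = N then 2 * k + ∑ δ ∈ N.properDivisors, s δ else -s δ, ?_, ?_⟩
  · rw [← Nat.cons_self_properDivisors hN.ne', Finset.sum_cons, if_pos rfl,
      Finset.sum_congr rfl (g := fun δ => -s δ)
        (fun δ hδ => if_neg (by rintro rfl; exact hNn hδ)), Finset.sum_neg_distrib]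
    ring
  · rw [← Nat.cons_self_properDivisors hN.ne', Finset.sum_cons]
    have hrest : ∀ δ ∈ N.properDivisors, ((N / δ : ℕ) : ℤ) *
        (if δ = N then 2 * k + ∑ δ ∈ N.properDivisors, s δ else -s δ) =
          -(((N / δ - 1 : ℕ) : ℤ) * s δ) - s δ := fun δ hδ => by
      have hδ' : δ ≠ N := by rintro rfl; exact hNn hδ
      have h1 : 1 ≤ N / δ := Nat.div_pos (Nat.mem_properDivisors.mp hδ).2.le
        (Nat.pos_of_mem_properDivisors hδ)
      rw [if_neg hδ', Nat.cast_sub h1]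
      push_cast
      ring
    dsimp only
    rw [if_pos rfl, Finset.sum_congr rfl hrest, Finset.sum_sub_distrib, Finset.sum_neg_distrib,
      hsum, Nat.div_self hN]
    exact ⟨y * w, by push_cast; ring⟩

theorem exists_exponents_mod_three {N : ℕ} (hN : 0 < N) {k : ℤ} (hN3 : 3 ∣ N)
    (h3 : 3 ∣ k ∨ ∃ p : ℕ, p.Prime ∧ p ∣ N ∧ p % 3 = 2) :
    ∃ r : ℕ → ℤ, ∑ δ ∈ N.divisors, r δ = 2 * k ∧ 3 ∣ ∑ δ ∈ N.divisors, δ * r δ ∧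
      3 ∣ ∑ δ ∈ N.divisors, (N / δ : ℕ) * r δ := by
  have h1 : 1 ∈ N.divisors := Nat.one_mem_divisors.mpr hN.ne'
  rcases h3 with h | ⟨p, hp, hpN, hp3⟩
  · refine ⟨fun δ => if δ = 1 then 2 * k else 0, ?_, ?_, ?_⟩
    · simp [h1]
    · simpa [h1] using h.mul_left 2
    · simpa [h1] using (h.mul_left 2).mul_left N
  · have hpd : p ∈ N.divisors := Nat.mem_divisors.mpr ⟨hpN, hN.ne'⟩
    obtain ⟨m, rfl⟩ := hpN
    have hm : 3 ∣ m := by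
      refine ((Nat.Prime.dvd_mul Nat.prime_three).mp hN3).resolve_left fun h => ?_
      omega
    -- Modulo 3, `4k - 2kp ≡ 0` because `p ≡ 2`; the cofactors `N` and `N/p` are both divisible by
    -- 3.
    refine ⟨fun δ => (if δ = 1 then 4 * k else 0) + (if δ = p then -(2 * k) else 0), ?_, ?_, ?_⟩
    · simp only [Finset.sum_add_distrib, Finset.sum_ite_eq', h1, hpd, if_true]
      ring
    · simp only [mul_add, Finset.sum_add_distrib, mul_ite, mul_zero, Finset.sum_ite_eq', h1, hpd,
        if_true]
      have : (p : ℤ) % 3 = 2 := by exact_mod_cast hp3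
      obtain ⟨q, hq⟩ : ∃ q : ℤ, p = 3 * q + 2 := ⟨p / 3, by omega⟩
      rw [hq]
      exact ⟨-2 * q * k, by push_cast; ring⟩
    · simp only [mul_add, Finset.sum_add_distrib, mul_ite, mul_zero, Finset.sum_ite_eq', h1, hpd,
        if_true, Nat.div_one, Nat.mul_div_cancel_left m hp.pos]
      have hm' : (3 : ℤ) ∣ m := by exact_mod_cast hm
      push_cast
      exact dvd_add ((hm'.mul_left _).mul_right _) (hm'.mul_right _)

theorem exists_exponents {N : ℕ} (hodd : Odd N) {k : ℤ}
    (h3 : 3 ∣ N → 3 ∣ k ∨ ∃ p : ℕ, p.Prime ∧ p ∣ N ∧ p % 3 = 2)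
    (hk : ((Nat.gcd (N.properDivisors.gcd fun δ => N / δ - 1) 24 : ℕ) : ℤ) ∣ 2 * k) :
    ∃ r : ℕ → ℤ, ∑ δ ∈ N.divisors, r δ = 2 * k ∧ 24 ∣ ∑ δ ∈ N.divisors, δ * r δ ∧
      24 ∣ ∑ δ ∈ N.divisors, (N / δ : ℕ) * r δ := by
  have hN : 0 < N := hodd.pos
  obtain ⟨r, hr, hr24⟩ := exists_exponents_of_gcd_dvd hN hk
  have h8 : (8 : ℤ) ∣ ∑ δ ∈ N.divisors, δ * r δ := by
    refine sum_divisors_mul_congr r (fun m hm => ?_) (dvd_trans (by norm_num) hr24)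
    exact Int.eight_dvd_sq_sub_one_of_odd (by exact_mod_cast hodd.of_dvd_nat hm)
  by_cases hN3 : 3 ∣ N
  · obtain ⟨s, hs, hs1, hs2⟩ := exists_exponents_mod_three hN hN3 (h3 hN3)
    have hlin : ∀ u : ℕ → ℤ, ∑ δ ∈ N.divisors, u δ * (9 * r δ - 8 * s δ) =
        9 * ∑ δ ∈ N.divisors, u δ * r δ - 8 * ∑ δ ∈ N.divisors, u δ * s δ := fun u => by
      rw [Finset.mul_sum, Finset.mul_sum, ← Finset.sum_sub_distrib]
      exact Finset.sum_congr rfl fun δ _ => by ring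
    -- Chinese remaindering: the combination is `r` modulo 8 and `s` modulo 3, and `9 - 8 = 1`
    -- preserves the total `2k`.
    refine ⟨fun δ => 9 * r δ - 8 * s δ, ?_, ?_, ?_⟩
    · have := hlin fun _ => 1
      simp only [one_mul] at this
      rw [this, hr, hs]
      ring
    · rw [hlin fun δ => (δ : ℤ)]
      omega
    · rw [hlin fun δ => ((N / δ : ℕ) : ℤ)]
      omega
  · have h3' : (3 : ℤ) ∣ ∑ δ ∈ N.divisors, δ * r δ := by
      refine sum_divisors_mul_congr r (fun m hm => ?_) (dvd_trans (by norm_num) hr24)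
      have : ¬ 3 ∣ m := fun h => hN3 (h.trans hm)
      have hm3 : m % 3 = 1 ∨ m % 3 = 2 := by omega
      rw [Int.dvd_iff_emod_eq_zero, Int.sub_emod, pow_two, Int.mul_emod]
      rcases hm3 with h | h
      · rw [show (m : ℤ) % 3 = 1 by omega]; rfl
      · rw [show (m : ℤ) % 3 = 2 by omega]; rfl
    exact ⟨r, hr, by omega, hr24⟩

theorem mainTheorem6 (N : ℕ) (hodd : Odd N) (hsq : Squarefree N) (k : ℤ)
    (h3 : 3 ∣ N → 3 ∣ k ∨ ∃ p : ℕ, p.Prime ∧ p ∣ N ∧ p % 3 = 2)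
    (hk : ((Nat.gcd (N.properDivisors.gcd fun δ => N / δ - 1) 24 : ℕ) : ℤ) ∣ 2 * k) :
    ∃ f ∈ weaklyModularFunctions (Gamma1 N) k, IsEtaQuotient N f := by
  obtain ⟨r, hr, hr1, hr2⟩ := exists_exponents hodd h3 hk
  exact ⟨etaQuotient N r, ⟨etaQuotient_mdifferentiable N r,
    fun γ hγ => etaQuotient_slash hodd hr hr1 hr2 hγ,
    etaQuotient_slash_meromorphicAtImInfty hodd.pos hr⟩, r, rfl⟩
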